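/- Consider one queue and two servers in discrete time $t=0,1,2,\dots$. Packets arrive as a Bernoulli process $A(t)$ of rate $\lambda$; server $i\in\{1,2\}$ offers service according to a Bernoulli process $D^i(t)$ of rate $\mu_i\in[0,1]$; all these processes are independent. At each time $t$ the controller chooses one server $u(t)$, observes its offered service $D(t)=D^{u(t)}(t)$, and the backlog evolves by $Q(0)=0$, $Q(t+1)=(Q(t)-D(t))^+ + A(t)$. A policy $\pi$ makes the (possibly randomized) decision $u(t)$ from the history $(A(s),D(s),u(s))_{s<t}$, without knowing $\lambda$ or $\vec\mu=(\mu_1,\mu_2)$; it does not use previous observations of the arrival process if its decision $u(t)$ depends on the history only through $(D(s),u(s))_{s<t}$. Write $\mu_{(1)}\le\mu_{(2)}$ for the sorted rates, $Q^\pi$ for the backlog under $\pi$, $Q^*$ for the backlog under the controller that always schedules the server with the largest rate, and $$R^\pi_{(\lambda,\vec\mu)}(T)=E\Big[\sum_{t=0}^{T-1}Q^\pi(t)-\sum_{t=0}^{T-1}Q^*(t)\Big]$$ for the queue length regret, where the expectation is over the product of the laws of the two systems. Here $f(T)=\Omega(g(T))$ means that there is $M>0$ such that for every $T_0$ there is $T>T_0$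 with $|f(T)|\ge M\,g(T)$. Theorem. For every policy $\pi$ that does not use previous observations of the arrival process there is a rate vector $\vec\mu$ with $\mu_{(1)}<\mu_{(2)}$ such that for every $\lambda\in(0,\mu_{(2)})$, $$R^\pi_{(\lambda,\vec\mu)}(T)=\Omega(\log T).$$ -/

import Mathlib

open MeasureTheory ProbabilityTheory
open scoped unitInterval

noncomputable section

/-- What is recorded in one time slot: the arrival `A(t)`, the service `D(t)` offered by the
scheduled server (both `true` for one packet and `false` for none), and the decision `u(t)`. -/
abbrev Slot (N : ℕ) : Type := Bool × Bool × Fin N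

/-- The history `H(t) = (A(0), D(0), u(0), …, A(t-1), D(t-1), u(t-1))`. -/
abbrev History (N t : ℕ) : Type := Fin t → Slot N

/-- A (possibly randomized) policy: at each time `t`, the history `H(t)` determines the
distribution of the decision `u(t)`. -/
abbrev Policy (N : ℕ) : Type := (t : ℕ) → History N t → PMF (Fin N)

/-- The policy does not use observations of the arrival process: its decisions depend on the
history only through the offered services and the decisions. -/
def Policy.IgnoresArrivals {N : ℕ} (π : Policy N) : Prop :=
  ∀ (t : ℕ) (h h' : History N t), (∀ s, (h s).2 = (h' s).2) → π t h = π t h'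

/-- The controller that schedules server `i` in every time slot. -/
def Policy.always {N : ℕ} (i : Fin N) : Policy N := fun _ _ => PMF.pure i

/-- The distribution of `A(t)`, Bernoulli with rate `lam`. -/
def arrivalLaw (lam : I) : PMF Bool := (bernoulliMeasure true false lam).toPMF

/-- The joint distribution of `(D^1(t), …, D^N(t))`: independent, Bernoulli with rates `μ i`. -/
def serviceLaw {N : ℕ} (μ : Fin N → I) : PMF (Fin N → Bool) :=
  (Measure.pi fun i => bernoulliMeasure true false (μ i)).toPMF

/-- The distribution of the history `H(t)` under the policy `π` in the problem `(lam, μ)`. In each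
slot the decision is drawn by the policy from the history alone, the arrival and the services of all
servers are drawn independently of each other, of the decision and of the past, and the service of
the scheduled server is recorded. -/
def historyLaw {N : ℕ} (π : Policy N) (lam : I) (μ : Fin N → I) : (t : ℕ) → PMF (History N t)
  | 0 => PMF.pure Fin.elim0
  | t + 1 =>
    (historyLaw π lam μ t).bind fun h =>
    (π t h).bind fun u =>
    (arrivalLaw lam).bind fun a =>
    (serviceLaw μ).bind fun d =>
    PMF.pure (Fin.snoc h (a, d u, u))

/-- The backlog `Q(t)` as a function of `H(t)`: `Q(0) = 0` and `Q(t+1) = (Q(t) - D(t))⁺ + A(t)`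
(subtraction of natural numbers is truncated at `0`). -/
def backlog {N : ℕ} : (t : ℕ) → History N t → ℕ
  | 0, _ => 0
  | t + 1, h =>
    (backlog t (Fin.init h) - (h (Fin.last t)).2.1.toNat) + (h (Fin.last t)).1.toNat

/-- The total backlog `∑_{t=0}^{T-1} Q(t)` along a history of length `T`. -/
def totalBacklog {N : ℕ} (T : ℕ) (h : History N T) : ℕ :=
  ∑ t : Fin T, backlog t (Fin.take t t.is_lt.le h)

/-- The best server `i* = argmax_i μ i` (a choice of one if there are several). -/
def bestServer {N : ℕ} [NeZero N] (μ : Fin N → I) : Fin N :=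
  Classical.choose (Finite.exists_max μ)

/-- The queue length regret: the expectation of `∑_{t<T} Q^π(t) - ∑_{t<T} Q^*(t)` with respect to
the product of the laws of the system under `π` and of the system that always schedules `i*`. -/
def regret {N : ℕ} [NeZero N] (π : Policy N) (lam : I) (μ : Fin N → I) (T : ℕ) : ℝ :=
  ∫ p : History N T × History N T,
    ((totalBacklog T p.1 : ℝ) - (totalBacklog T p.2 : ℝ))
    ∂((historyLaw π lam μ T).toMeasure.prod
      (historyLaw (Policy.always (bestServer μ)) lam μ T).toMeasure)

/-- `f(T) = Ω(g(T))`: there is `M > 0` such that `|f(T)| ≥ M g(T)` for arbitrarily large `T`. -/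
def IsBigOmega (f g : ℕ → ℝ) : Prop :=
  ∃ M : ℝ, 0 < M ∧ ∀ T₀ : ℕ, ∃ T : ℕ, T₀ < T ∧ M * g T ≤ |f T|

end

/-! Right after an arrival the queue is nonempty, and a policy blind to arrivals cannot exploit
this: its next decision is independent of that arrival. Scheduling a worse server therefore costs at
least `lam` times the gap in expected backlog, since the always-best controller stochastically
minimizes the backlog. Thus `gap_mul_sum_pullProb_le_regret` reduces regret to counting pulls.

The law of the pulls is free of `lam`, which leaves a bandit problem. Rates (1/2, 1/4) and (1/2,
3/4) have different best servers, and only pulls of server 1 tell them apart, each multiplying the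
likelihood by at least 1/3. If server 1 has fewer than `log T / 8` expected pulls under the first,
the likelihood ratio is at least `T^(-1/2)` with probability at least 1/2, and server 0 gets at
least order `√T` expected pulls under the second (`log_le_pulls_or_log_le_pulls`). -/

/-! ### Expectations over finite probability spaces -/

/-- The expectation of `f` under a probability mass function on a finite type. -/
def PMF.expect {α : Type*} [Fintype α] (p : PMF α) (f : α → ℝ) : ℝ :=
  ∑ a, (p a).toReal * f a

/-- The expectation of `g` under the Bernoulli distribution of rate `p`. -/
def bernoulliMean (p : I) (g : Bool → ℝ) : ℝ :=
  p * g true + (1 - p) * g false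

namespace PMF

variable {α β : Type*} [Fintype α] [Fintype β]

theorem sum_toReal (p : PMF α) : ∑ a, (p a).toReal = 1 := by
  rw [← ENNReal.toReal_sum fun a _ => p.apply_ne_top a, ← tsum_fintype (L := .unconditional α),
    p.tsum_coe, ENNReal.toReal_one]

theorem expect_const (p : PMF α) (c : ℝ) : p.expect (fun _ => c) = c := by
  rw [expect, ← Finset.sum_mul, p.sum_toReal, one_mul]

theorem expect_mono (p : PMF α) {f g : α → ℝ} (h : ∀ a, f a ≤ g a) : p.expect f ≤ p.expect g :=
  Finset.sum_le_sum fun a _ => mul_le_mul_of_nonneg_left (h a) ENNReal.toReal_nonneg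

theorem expect_nonneg (p : PMF α) {f : α → ℝ} (h : ∀ a, 0 ≤ f a) : 0 ≤ p.expect f :=
  Finset.sum_nonneg fun a _ => mul_nonneg ENNReal.toReal_nonneg (h a)

theorem expect_add (p : PMF α) (f g : α → ℝ) :
    p.expect (fun a => f a + g a) = p.expect f + p.expect g := by
  simp only [expect, mul_add, Finset.sum_add_distrib]

theorem expect_const_mul (p : PMF α) (c : ℝ) (f : α → ℝ) :
    p.expect (fun a => c * f a) = c * p.expect f := by
  simp only [expect, Finset.mul_sum]
  exact Finset.sum_congr rfl fun a _ => by ring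

theorem expect_sub (p : PMF α) (f g : α → ℝ) :
    p.expect (fun a => f a - g a) = p.expect f - p.expect g := by
  simp only [expect, mul_sub, Finset.sum_sub_distrib]

theorem expect_pure (a : α) (f : α → ℝ) : (PMF.pure a).expect f = f a := by
  classical
  rw [expect, Finset.sum_eq_single a]
  · simp
  · intro b _ hb
    simp [PMF.pure_apply, hb]
  · simp

theorem expect_bind (p : PMF α) (k : α → PMF β) (f : β → ℝ) :
    (p.bind k).expect f = p.expect fun a => (k a).expect f := by
  simp only [expect, PMF.bind_apply, tsum_fintype, Finset.mul_sum]
  rw [Finset.sum_comm]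
  refine Finset.sum_congr rfl fun b _ => ?_
  rw [ENNReal.toReal_sum fun a _ => ENNReal.mul_ne_top (p.apply_ne_top a) ((k a).apply_ne_top b),
    Finset.sum_mul]
  exact Finset.sum_congr rfl fun a _ => by rw [ENNReal.toReal_mul, mul_assoc]

theorem integral_eq_expect [MeasurableSpace α] [MeasurableSingletonClass α] (p : PMF α)
    (f : α → ℝ) : ∫ a, f a ∂p.toMeasure = p.expect f := by
  rw [PMF.integral_eq_sum]
  rfl

theorem expect_toPMF [MeasurableSpace α] [MeasurableSingletonClass α] (ν : Measure α)
    [IsProbabilityMeasure ν] (f : α → ℝ) : ν.toPMF.expect f = ∫ a, f a ∂ν := by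
  rw [← integral_eq_expect, Measure.toPMF_toMeasure]

end PMF

theorem integral_bernoulli_bool (p : I) (g : Bool → ℝ) :
    ∫ b, g b ∂(bernoulliMeasure true false p) = bernoulliMean p g := by
  rw [integral_bernoulliMeasure]
  simp [bernoulliMean]

theorem expect_arrivalLaw (lam : I) (g : Bool → ℝ) :
    (arrivalLaw lam).expect g = bernoulliMean lam g := by
  rw [arrivalLaw, PMF.expect_toPMF, integral_bernoulli_bool]

theorem expect_serviceLaw_apply {N : ℕ} (μ : Fin N → I) (u : Fin N) (g : Bool → ℝ) :
    ((serviceLaw μ).expect fun d => g (d u)) = bernoulliMean (μ u) g := by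
  have hmap := (measurePreserving_eval (fun i => bernoulliMeasure true false (μ i)) u).map_eq
  have hint := integral_map (μ := Measure.pi fun i => bernoulliMeasure true false (μ i))
    (measurable_pi_apply u).aemeasurable (f := g) (by fun_prop)
  rw [serviceLaw, PMF.expect_toPMF, ← integral_bernoulli_bool, ← hint]
  exact congrArg (fun ν => ∫ b, g b ∂ν) hmap

/-! ### Bernoulli means -/

theorem bernoulliMean_mono (p : I) {f g : Bool → ℝ} (h : ∀ b, f b ≤ g b) :
    bernoulliMean p f ≤ bernoulliMean p g :=
  add_le_add (mul_le_mul_of_nonneg_left (h _) p.2.1)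
    (mul_le_mul_of_nonneg_left (h _) (sub_nonneg.2 p.2.2))

theorem bernoulliMean_const (p : I) (c : ℝ) : bernoulliMean p (fun _ => c) = c := by
  rw [bernoulliMean]
  ring

theorem bernoulliMean_nonneg (p : I) {f : Bool → ℝ} (h : ∀ b, 0 ≤ f b) : 0 ≤ bernoulliMean p f :=
  (bernoulliMean_const p 0).symm.le.trans (bernoulliMean_mono p h)

theorem bernoulliMean_antitone_rate {p p' : I} (hp : p ≤ p') {f : Bool → ℝ}
    (hf : f true ≤ f false) : bernoulliMean p' f ≤ bernoulliMean p f := by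
  have : (p : ℝ) ≤ p' := hp
  simp only [bernoulliMean]
  nlinarith

/-! ### One step of the controlled system -/

section Step

variable {N : ℕ}

theorem expect_historyLaw_zero (π : Policy N) (lam : I) (μ : Fin N → I) (f : History N 0 → ℝ) :
    (historyLaw π lam μ 0).expect f = f Fin.elim0 :=
  PMF.expect_pure _ _

/-- Only the scheduled server is observed, so the joint service law enters through one marginal. -/
theorem expect_historyLaw_succ (π : Policy N) (lam : I) (μ : Fin N → I) (t : ℕ)
    (f : History N (t + 1) → ℝ) :
    (historyLaw π lam μ (t + 1)).expect f = (historyLaw π lam μ t).expect fun h =>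
      (π t h).expect fun u => bernoulliMean lam fun a => bernoulliMean (μ u) fun d =>
        f (Fin.snoc h (a, d, u)) := by
  simp only [historyLaw, PMF.expect_bind, PMF.expect_pure, expect_arrivalLaw]
  congr! 6 with h u a
  exact expect_serviceLaw_apply μ u fun d => f (Fin.snoc h (a, d, u))

theorem expect_historyLaw_init (π : Policy N) (lam : I) (μ : Fin N → I) (t : ℕ)
    (f : History N t → ℝ) :
    ((historyLaw π lam μ (t + 1)).expect fun h => f (Fin.init h)) =
      (historyLaw π lam μ t).expect f := by
  simp [expect_historyLaw_succ, bernoulliMean_const, PMF.expect_const]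

/-- A function of the history that depends only on the offered services and the decisions. -/
def HistoryFunctionIgnoresArrivals {t : ℕ} (f : History N t → ℝ) : Prop :=
  ∀ h h' : History N t, (∀ s, (h s).2 = (h' s).2) → f h = f h'

theorem snoc_congr_snd {t : ℕ} {h h' : History N t} (hh : ∀ s, (h s).2 = (h' s).2) (a a' : Bool)
    (x : Bool × Fin N) (s : Fin (t + 1)) :
    ((Fin.snoc h (a, x) : History N (t + 1)) s).2 =
      ((Fin.snoc h' (a', x) : History N (t + 1)) s).2 := by
  refine Fin.lastCases ?_ (fun s => ?_) s
  · simp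
  · simpa using hh s

/-- Under a policy that ignores the arrivals, the law of the services and decisions does not depend
on the arrival rate. -/
theorem expect_historyLaw_arrivalRate_congr {π : Policy N} (hπ : π.IgnoresArrivals)
    (lam lam' : I) (μ : Fin N → I) (t : ℕ) (f : History N t → ℝ)
    (hf : HistoryFunctionIgnoresArrivals f) :
    (historyLaw π lam μ t).expect f = (historyLaw π lam' μ t).expect f := by
  induction t with
  | zero => rfl
  | succ t ih =>
    -- Fixing the recorded arrival to `false` makes the integrand the same for every rate.
    have key : ∀ l : I, (historyLaw π l μ (t + 1)).expect f =
        (historyLaw π l μ t).expect fun h => (π t h).expect fun u =>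
          bernoulliMean (μ u) fun d => f (Fin.snoc h (false, d, u)) := by
      intro l
      rw [expect_historyLaw_succ]
      congr! 4 with h u
      rw [← bernoulliMean_const l (bernoulliMean (μ u) _)]
      congr! 4 with a d
      exact hf _ _ (snoc_congr_snd (fun _ => rfl) _ _ _)
    rw [key, key]
    refine ih _ fun h h' hh => ?_
    rw [hπ t h h' hh]
    congr! 4 with u d
    exact hf _ _ (snoc_congr_snd hh _ _ _)

/-- The last arrival is independent of the services and decisions recorded so far. -/
theorem le_expect_historyLaw_of_last_arrival {π : Policy N} (lam : I) (μ : Fin N → I) (t : ℕ)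
    (f g : History N (t + 1) → ℝ) (hf : HistoryFunctionIgnoresArrivals f) (hg : ∀ h, 0 ≤ g h)
    (hfg : ∀ h, (h (Fin.last t)).1 = true → f h ≤ g h) :
    lam * (historyLaw π lam μ (t + 1)).expect f ≤ (historyLaw π lam μ (t + 1)).expect g := by
  rw [expect_historyLaw_succ, expect_historyLaw_succ, ← PMF.expect_const_mul]
  refine PMF.expect_mono _ fun h => ?_
  rw [← PMF.expect_const_mul]
  refine PMF.expect_mono _ fun u => ?_
  have hconst : (bernoulliMean lam fun a => bernoulliMean (μ u) fun d => f (Fin.snoc h (a, d, u)))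
      = bernoulliMean (μ u) fun d => f (Fin.snoc h (true, d, u)) := by
    rw [← bernoulliMean_const lam (bernoulliMean (μ u) fun d => f (Fin.snoc h (true, d, u)))]
    congr! 4 with a d
    exact hf _ _ (snoc_congr_snd (fun _ => rfl) _ _ _)
  rw [hconst]
  calc (lam : ℝ) * (bernoulliMean (μ u) fun d => f (Fin.snoc h (true, d, u)))
      ≤ lam * (bernoulliMean (μ u) fun d => g (Fin.snoc h (true, d, u))) :=
        mul_le_mul_of_nonneg_left
          (bernoulliMean_mono _ fun d => hfg _ (by simp)) lam.2.1
    _ ≤ _ := le_add_of_nonneg_right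
        (mul_nonneg (sub_nonneg.2 lam.2.2) (bernoulliMean_nonneg _ fun d => hg _))

end Step

/-! ### Backlogs -/

/-- The expectation of `g` at the next backlog when the backlog is `q`, the arrival rate is `lam`
and the scheduled server has rate `p`. -/
def serveMean (lam p : I) (g : ℕ → ℝ) (q : ℕ) : ℝ :=
  bernoulliMean lam fun a => bernoulliMean p fun d => g ((q - d.toNat) + a.toNat)

theorem serveMean_mono_backlog (lam p : I) {g : ℕ → ℝ} (hg : Monotone g) :
    Monotone (serveMean lam p g) := fun _ _ hq =>
  bernoulliMean_mono _ fun _ => bernoulliMean_mono _ fun _ =>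
    hg (Nat.add_le_add_right (Nat.sub_le_sub_right hq _) _)

theorem serveMean_antitone_rate (lam : I) {p p' : I} (hp : p ≤ p') {g : ℕ → ℝ} (hg : Monotone g)
    (q : ℕ) : serveMean lam p' g q ≤ serveMean lam p g q :=
  bernoulliMean_mono _ fun _ => bernoulliMean_antitone_rate hp (hg (by simp))

/-- Service offered to an empty queue is wasted, hence the indicator. -/
theorem serveMean_cast (lam p : I) (q : ℕ) :
    serveMean lam p (fun n => (n : ℝ)) q = q + lam - p * (if 1 ≤ q then 1 else 0) := by
  rcases q with _ | q
  · simp [serveMean, bernoulliMean]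
  · simp [serveMean, bernoulliMean]
    ring

section Backlog

variable {N : ℕ}

theorem expect_backlog_succ (π : Policy N) (lam : I) (μ : Fin N → I) (t : ℕ) (g : ℕ → ℝ) :
    ((historyLaw π lam μ (t + 1)).expect fun h => g (backlog (t + 1) h)) =
      (historyLaw π lam μ t).expect fun h =>
        (π t h).expect fun u => serveMean lam (μ u) g (backlog t h) := by
  simp [expect_historyLaw_succ, backlog, serveMean]

theorem expect_backlog_always_succ (i : Fin N) (lam : I) (μ : Fin N → I) (t : ℕ) (g : ℕ → ℝ) :
    ((historyLaw (Policy.always i) lam μ (t + 1)).expect fun h => g (backlog (t + 1) h)) =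
      (historyLaw (Policy.always i) lam μ t).expect fun h =>
        serveMean lam (μ i) g (backlog t h) := by
  simp [expect_backlog_succ, Policy.always, PMF.expect_pure]

/-- Always scheduling a best server stochastically minimizes the backlog. -/
theorem expect_backlog_always_le (π : Policy N) (lam : I) {μ : Fin N → I} {i : Fin N}
    (hi : ∀ j, μ j ≤ μ i) (t : ℕ) {g : ℕ → ℝ} (hg : Monotone g) :
    ((historyLaw (Policy.always i) lam μ t).expect fun h => g (backlog t h)) ≤
      (historyLaw π lam μ t).expect fun h => g (backlog t h) := by
  induction t generalizing g with
  | zero => simp [expect_historyLaw_zero]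
  | succ t ih =>
    rw [expect_backlog_always_succ, expect_backlog_succ]
    -- The one-step operator preserves monotonicity, which is why the induction is over all monotone
    -- `g`.
    refine (ih (serveMean_mono_backlog lam (μ i) hg)).trans (PMF.expect_mono _ fun h => ?_)
    rw [← (π t h).expect_const (serveMean lam (μ i) g (backlog t h))]
    exact PMF.expect_mono _ fun u => serveMean_antitone_rate lam (hi u) hg _

/-- The probability that the policy schedules server `i` at time `t`. -/
noncomputable def pullProb (π : Policy N) (lam : I) (μ : Fin N → I) (i : Fin N) (t : ℕ) : ℝ :=
  (historyLaw π lam μ t).expect fun h => (π t h i).toReal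

theorem pullProb_le_one (π : Policy N) (lam : I) (μ : Fin N → I) (i : Fin N) (t : ℕ) :
    pullProb π lam μ i t ≤ 1 := by
  rw [← (historyLaw π lam μ t).expect_const 1]
  exact PMF.expect_mono _ fun h => ENNReal.toReal_le_of_le_ofReal zero_le_one
    (by simpa using PMF.coe_le_one _ _)

theorem ignoresArrivals_decision {π : Policy N} (hπ : π.IgnoresArrivals) (i : Fin N) (t : ℕ) :
    HistoryFunctionIgnoresArrivals fun h : History N t => (π t h i).toReal :=
  fun h h' hh => by simp only [hπ t h h' hh]

/-- This allows one rate vector to serve every `lam`. -/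
theorem pullProb_arrivalRate_congr {π : Policy N} (hπ : π.IgnoresArrivals) (lam lam' : I)
    (μ : Fin N → I) (i : Fin N) (t : ℕ) : pullProb π lam μ i t = pullProb π lam' μ i t :=
  expect_historyLaw_arrivalRate_congr hπ lam lam' μ t _ (ignoresArrivals_decision hπ i t)

/-- Scheduling a worse server right after an arrival costs the gap between the rates. -/
theorem gap_mul_pullProb_le_expect_backlog_sub {π : Policy N} (hπ : π.IgnoresArrivals) (lam : I)
    {μ : Fin N → I} {i : Fin N} (hi : ∀ j, μ j ≤ μ i) (j : Fin N) (t : ℕ) :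
    (μ i - μ j : ℝ) * (lam * pullProb π lam μ j (t + 1)) ≤
      ((historyLaw π lam μ (t + 2)).expect fun h => (backlog (t + 2) h : ℝ)) -
        (historyLaw (Policy.always i) lam μ (t + 2)).expect fun h => (backlog (t + 2) h : ℝ) := by
  have hmono : Monotone fun n : ℕ => (n : ℝ) := Nat.mono_cast
  have hgap : (0 : ℝ) ≤ μ i - μ j := sub_nonneg.2 (hi j)
  -- Intermediate system: follow `π` up to time `t + 1`, then use server `i` for one slot.
  have hstar := expect_backlog_always_le π lam hi (t + 1)
    (serveMean_mono_backlog lam (μ i) hmono)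
  rw [← expect_backlog_always_succ] at hstar
  have hbusy := le_expect_historyLaw_of_last_arrival (π := π) lam μ t
    (fun h => (π (t + 1) h j).toReal)
    (fun h => (π (t + 1) h j).toReal * if 1 ≤ backlog (t + 1) h then 1 else 0)
    (ignoresArrivals_decision hπ j (t + 1))
    (fun h => mul_nonneg ENNReal.toReal_nonneg (by split_ifs <;> norm_num))
    (fun h ha => by simp [backlog, ha])
  have hstep : ((historyLaw π lam μ (t + 1)).expect fun h =>
        serveMean lam (μ i) (fun n => (n : ℝ)) (backlog (t + 1) h) + (μ i - μ j : ℝ) *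
          ((π (t + 1) h j).toReal * if 1 ≤ backlog (t + 1) h then 1 else 0)) ≤
      (historyLaw π lam μ (t + 2)).expect fun h => (backlog (t + 2) h : ℝ) := by
    rw [expect_backlog_succ π lam μ (t + 1) fun n => (n : ℝ)]
    refine PMF.expect_mono _ fun h => ?_
    set q := backlog (t + 1) h
    have hdecomp : (π (t + 1) h).expect (fun u => serveMean lam (μ u) (fun n => (n : ℝ)) q) =
        serveMean lam (μ i) (fun n => (n : ℝ)) q +
          (π (t + 1) h).expect fun u => (μ i - μ u : ℝ) * if 1 ≤ q then 1 else 0 := by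
      rw [← (π (t + 1) h).expect_const (serveMean lam (μ i) (fun n => (n : ℝ)) q),
        ← PMF.expect_add]
      congr! 2 with u
      rw [serveMean_cast, serveMean_cast]
      ring
    rw [hdecomp]
    refine add_le_add_right ?_ _
    have hterm := Finset.single_le_sum (s := Finset.univ)
      (f := fun u => (π (t + 1) h u).toReal * ((μ i - μ u : ℝ) * if 1 ≤ q then 1 else 0))
      (fun u _ => mul_nonneg ENNReal.toReal_nonneg
        (mul_nonneg (sub_nonneg.2 (hi u)) (by split_ifs <;> norm_num))) (Finset.mem_univ j)
    refine le_trans (le_of_eq ?_) hterm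
    ring
  rw [PMF.expect_add, PMF.expect_const_mul] at hstep
  have := mul_le_mul_of_nonneg_left hbusy hgap
  rw [pullProb]
  linarith

theorem totalBacklog_succ (T : ℕ) (h : History N (T + 1)) :
    totalBacklog (T + 1) h = totalBacklog T (Fin.init h) + backlog T (Fin.init h) := by
  rw [totalBacklog, Fin.sum_univ_castSucc]
  rfl

theorem expect_totalBacklog (π : Policy N) (lam : I) (μ : Fin N → I) (T : ℕ) :
    ((historyLaw π lam μ T).expect fun h => (totalBacklog T h : ℝ)) =
      ∑ t ∈ Finset.range T, (historyLaw π lam μ t).expect fun h => (backlog t h : ℝ) := by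
  induction T with
  | zero => simp [expect_historyLaw_zero, totalBacklog]
  | succ T ih =>
    rw [Finset.sum_range_succ, ← ih, ← PMF.expect_add,
      ← expect_historyLaw_init π lam μ T fun h => (totalBacklog T h : ℝ) + (backlog T h : ℝ)]
    simp only [totalBacklog_succ, Nat.cast_add]

theorem regret_eq_sum [NeZero N] (π : Policy N) (lam : I) (μ : Fin N → I) (T : ℕ) :
    regret π lam μ T = ∑ t ∈ Finset.range T,
      (((historyLaw π lam μ t).expect fun h => (backlog t h : ℝ)) -
        (historyLaw (Policy.always (bestServer μ)) lam μ t).expect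
          fun h => (backlog t h : ℝ)) := by
  rw [Finset.sum_sub_distrib, ← expect_totalBacklog, ← expect_totalBacklog, regret,
    integral_sub (Integrable.of_finite) (Integrable.of_finite),
    integral_fun_fst (fun h => (totalBacklog T h : ℝ)),
    integral_fun_snd (fun h => (totalBacklog T h : ℝ)),
    PMF.integral_eq_expect, PMF.integral_eq_expect]
  simp

theorem le_bestServer [NeZero N] (μ : Fin N → I) (j : Fin N) : μ j ≤ μ (bestServer μ) :=
  Classical.choose_spec (Finite.exists_max μ) j

/-- The regret of a policy that ignores the arrivals is at least proportional to the expected number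
of times that it schedules a given server. -/
theorem gap_mul_sum_pullProb_le_regret [NeZero N] {π : Policy N} (hπ : π.IgnoresArrivals)
    (lam : I) (μ : Fin N → I) (j : Fin N) (T : ℕ) :
    (μ (bestServer μ) - μ j : ℝ) * lam * (∑ t ∈ Finset.range T, pullProb π lam μ j t - 2) ≤
      regret π lam μ T := by
  have hgap : (0 : ℝ) ≤ (μ (bestServer μ) - μ j : ℝ) * lam :=
    mul_nonneg (sub_nonneg.2 (le_bestServer μ j)) lam.2.1
  have hdiff : ∀ t, 0 ≤ ((historyLaw π lam μ t).expect fun h => (backlog t h : ℝ)) -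
      (historyLaw (Policy.always (bestServer μ)) lam μ t).expect fun h => (backlog t h : ℝ) :=
    fun t => sub_nonneg.2 (expect_backlog_always_le π lam (le_bestServer μ) t Nat.mono_cast)
  rw [regret_eq_sum]
  rcases T with _ | _ | T
  · simp only [Finset.range_zero, Finset.sum_empty]
    nlinarith
  · refine le_trans ?_ (Finset.sum_nonneg fun t _ => hdiff t)
    rw [Finset.sum_range_one]
    nlinarith [pullProb_le_one π lam μ j 0]
  -- The `2` pays for two pulls: at time 0 the queue is empty, and the last decision affects only a
  -- backlog outside the sum.
  · rw [Finset.sum_range_succ (pullProb π lam μ j), Finset.sum_range_succ' (pullProb π lam μ j),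
      Finset.sum_range_succ', Finset.sum_range_succ']
    have hsum : (μ (bestServer μ) - μ j : ℝ) * lam *
        ∑ t ∈ Finset.range T, pullProb π lam μ j (t + 1) ≤ ∑ t ∈ Finset.range T,
          (((historyLaw π lam μ (t + 2)).expect fun h => (backlog (t + 2) h : ℝ)) -
            (historyLaw (Policy.always (bestServer μ)) lam μ (t + 2)).expect
              fun h => (backlog (t + 2) h : ℝ)) := by
      rw [Finset.mul_sum]
      refine Finset.sum_le_sum fun t _ => ?_
      rw [mul_assoc]
      exact gap_mul_pullProb_le_expect_backlog_sub hπ lam (le_bestServer μ) j t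
    have hends : (μ (bestServer μ) - μ j : ℝ) * lam *
        (pullProb π lam μ j 0 + pullProb π lam μ j (T + 1) - 2) ≤ 0 :=
      mul_nonpos_of_nonneg_of_nonpos hgap
        (by linarith [pullProb_le_one π lam μ j 0, pullProb_le_one π lam μ j (T + 1)])
    have h0 := hdiff 0
    have h1 := hdiff 1
    simp only [add_assoc, Nat.reduceAdd] at hsum h0 h1 ⊢
    linarith

end Backlog

/-! ### The number of times that a server is scheduled -/

section Pulls

variable {N : ℕ}

/-- The number of slots of a history in which server `i` was scheduled. -/
def pullCount (i : Fin N) {T : ℕ} (h : History N T) : ℕ :=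
  ∑ s, if (h s).2.2 = i then 1 else 0

theorem pullCount_snoc (i : Fin N) {T : ℕ} (h : History N T) (a d : Bool) (u : Fin N) :
    pullCount i (Fin.snoc h (a, d, u) : History N (T + 1)) =
      pullCount i h + if u = i then 1 else 0 := by
  rw [pullCount, Fin.sum_univ_castSucc]
  simp only [Fin.snoc_castSucc, Fin.snoc_last]
  rfl

theorem expect_pullCount (π : Policy N) (lam : I) (μ : Fin N → I) (i : Fin N) (T : ℕ) :
    ((historyLaw π lam μ T).expect fun h => (pullCount i h : ℝ)) =
      ∑ t ∈ Finset.range T, pullProb π lam μ i t := by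
  induction T with
  | zero => simp [expect_historyLaw_zero, pullCount]
  | succ T ih =>
    rw [Finset.sum_range_succ, ← ih, pullProb, ← PMF.expect_add, expect_historyLaw_succ]
    simp only [pullCount_snoc, bernoulliMean_const, Nat.cast_add, PMF.expect_add,
      PMF.expect_const]
    simp [PMF.expect]

/-- Change of measure between two rate vectors that differ only at server `i`, when a single
observation of that server has likelihood ratio at least `ρ`. -/
theorem expect_historyLaw_change_rate (π : Policy N) (lam : I) {μ μ' : Fin N → I} {i : Fin N}
    (hμ : ∀ j, j ≠ i → μ' j = μ j) {ρ : ℝ} (hρ : 0 ≤ ρ) (htrue : ρ * μ i ≤ μ' i)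
    (hfalse : ρ * (1 - μ i) ≤ 1 - μ' i) (T : ℕ) (f : History N T → ℝ) (hf : ∀ h, 0 ≤ f h) :
    ((historyLaw π lam μ T).expect fun h => ρ ^ pullCount i h * f h) ≤
      (historyLaw π lam μ' T).expect f := by
  induction T with
  | zero => simp [expect_historyLaw_zero, pullCount]
  | succ T ih =>
    rw [expect_historyLaw_succ, expect_historyLaw_succ]
    refine le_trans (PMF.expect_mono _ fun h => ?_) (ih _ fun h => PMF.expect_nonneg _ fun u =>
      bernoulliMean_nonneg _ fun a => bernoulliMean_nonneg _ fun d => hf _)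
    rw [← PMF.expect_const_mul]
    refine PMF.expect_mono _ fun u => ?_
    have hscale : ∀ (p : I) (c : ℝ) (g : Bool → ℝ),
        bernoulliMean p (fun b => c * g b) = c * bernoulliMean p g := fun p c g => by
      simp only [bernoulliMean]
      ring
    rw [← hscale]
    refine bernoulliMean_mono _ fun a => ?_
    simp only [pullCount_snoc, pow_add, mul_assoc, hscale]
    refine mul_le_mul_of_nonneg_left ?_ (pow_nonneg hρ _)
    -- Only a pull of `i` uses a factor `ρ`; elsewhere the rates agree.
    by_cases hu : u = i
    · subst hu
      simp only [if_true, pow_one, bernoulliMean]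
      have h1 := mul_le_mul_of_nonneg_right htrue (hf (Fin.snoc h (a, true, u)))
      have h0 := mul_le_mul_of_nonneg_right hfalse (hf (Fin.snoc h (a, false, u)))
      linarith
    · simp [hu, hμ u hu]

theorem pullCount_add_pullCount {T : ℕ} (h : History 2 T) :
    pullCount 0 h + pullCount 1 h = T := by
  rw [pullCount, pullCount, ← Finset.sum_add_distrib]
  calc _ = ∑ _s : Fin T, 1 := Finset.sum_congr rfl fun s => by
          generalize (h s).2.2 = u
          fin_cases u <;> simp
    _ = T := by simp

end Pulls

/-! ### Two bandit problems that are hard to tell apart -/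

/-- As `log 3 ≤ 2`, the power is at least `T^(-1/2)`; the other factor is at least `T / 2`, and `√T
/ 4 ≥ log T / 8`. -/
theorem log_div_eight_le_rpow_mul {T : ℝ} (hT : 2 ≤ T) :
    Real.log T / 8 ≤
      ((1 / 3 : ℝ) ^ (Real.log T / 4) * (T - Real.log T / 4)) * (1 / 2) := by
  have hT0 : 0 < T := by linarith
  have hlog : Real.log T ≤ T := (Real.log_le_sub_one_of_pos hT0).trans (by linarith)
  have hlog0 : 0 ≤ Real.log T := Real.log_nonneg (by linarith)
  have hlog3 : Real.log 3 ≤ 2 := by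
    have := Real.log_le_sub_one_of_pos (show (0 : ℝ) < 3 by norm_num)
    linarith
  have hsqrt : 0 < √T := Real.sqrt_pos.2 hT0
  have hsq : √T * √T = T := Real.mul_self_sqrt hT0.le
  have hlogsqrt : Real.log T ≤ 2 * √T := by
    have h1 := Real.log_le_sub_one_of_pos hsqrt
    have h2 : Real.log T = 2 * Real.log √T := by rw [Real.log_sqrt hT0.le]; ring
    linarith
  have hpow : (√T)⁻¹ ≤ (1 / 3 : ℝ) ^ (Real.log T / 4) := by
    rw [← Real.exp_log hsqrt, ← Real.exp_neg, Real.rpow_def_of_pos (by norm_num),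
      Real.exp_le_exp, Real.log_sqrt hT0.le, one_div, Real.log_inv]
    nlinarith
  have hhalf : T / 2 ≤ T - Real.log T / 4 := by linarith
  have hprod : (√T)⁻¹ * (T / 2) ≤ (1 / 3 : ℝ) ^ (Real.log T / 4) * (T - Real.log T / 4) :=
    mul_le_mul hpow hhalf (by linarith) (by positivity)
  have hval : (√T)⁻¹ * (T / 2) = √T / 2 := by
    rw [← hsq]
    field_simp
    rw [Real.sqrt_sq hsqrt.le]
  linarith

/-- A Markov-type lower bound for the likelihood ratio `3⁻ⁿ` weighted by `T - n`. -/
theorem rpow_mul_markov_le {T : ℕ} {m : ℝ} (hm : 0 < m) (hmT : m ≤ T) (n k : ℕ)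
    (hnk : k + n = T) :
    ((1 / 3 : ℝ) ^ m * (T - m)) * (1 - n / m) ≤ (1 / 3 : ℝ) ^ n * k := by
  have hk : (k : ℝ) = T - n := by
    rw [← hnk]
    push_cast
    ring
  have hc : 0 ≤ (1 / 3 : ℝ) ^ m * (T - m) :=
    mul_nonneg (by positivity) (by linarith)
  -- Up to `m` both factors decrease in `n`; beyond `m` the left side is nonpositive.
  rcases le_or_gt (n : ℝ) m with hn | hn
  · calc ((1 / 3 : ℝ) ^ m * (T - m)) * (1 - n / m) ≤ (1 / 3 : ℝ) ^ m * (T - m) :=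
          mul_le_of_le_one_right hc (by linarith [div_nonneg (Nat.cast_nonneg (α := ℝ) n) hm.le])
      _ ≤ (1 / 3 : ℝ) ^ n * k := by
          rw [← Real.rpow_natCast, hk]
          exact mul_le_mul
            (Real.rpow_le_rpow_of_exponent_ge (by norm_num) (by norm_num) hn) (by linarith)
            (by linarith) (by positivity)
  · have : 1 < n / m := (one_lt_div hm).2 hn
    exact (mul_nonpos_of_nonneg_of_nonpos hc (by linarith)).trans (by positivity)

/-- The rate `k / 4`. -/
noncomputable def quarterRate (k : ℕ) (hk : k ≤ 4) : I :=
  ⟨k / 4, by positivity, by rw [div_le_one (by norm_num)]; exact_mod_cast hk⟩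

theorem log_le_pulls_or_log_le_pulls (π : Policy 2) (lam : I) {T : ℕ} (hT : 2 ≤ T) :
    Real.log T / 8 ≤ ∑ t ∈ Finset.range T,
        pullProb π lam ![quarterRate 2 (by norm_num), quarterRate 1 (by norm_num)] 1 t ∨
      Real.log T / 8 ≤ ∑ t ∈ Finset.range T,
        pullProb π lam ![quarterRate 2 (by norm_num), quarterRate 3 (by norm_num)] 0 t := by
  rw [or_iff_not_imp_left, not_le, ← expect_pullCount, ← expect_pullCount]
  intro hrare
  set μ : Fin 2 → I := ![quarterRate 2 (by norm_num), quarterRate 1 (by norm_num)] with hμ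
  set μ' : Fin 2 → I := ![quarterRate 2 (by norm_num), quarterRate 3 (by norm_num)] with hμ'
  have hTr : (2 : ℝ) ≤ T := by exact_mod_cast hT
  have hlog0 : 0 < Real.log T := Real.log_pos (by linarith)
  have hlog : Real.log T ≤ T := (Real.log_le_sub_one_of_pos (by linarith)).trans (by linarith)
  -- Twice the assumed bound on the mean, so Markov leaves probability 1/2.
  set m := Real.log T / 4 with hm
  have hm0 : 0 < m := by positivity
  have hchange := expect_historyLaw_change_rate π lam (μ := μ) (μ' := μ') (i := 1)
    (fun j hj => by
      have : j = 0 := by omega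
      subst this
      simp [hμ, hμ']) (ρ := 1 / 3) (by norm_num)
    (by simp [hμ, hμ', quarterRate]; norm_num) (by simp [hμ, hμ', quarterRate]; norm_num) T
    (fun h => (pullCount 0 h : ℝ)) (fun h => Nat.cast_nonneg _)
  refine le_trans ?_ hchange
  have hmarkov : (((1 / 3 : ℝ) ^ m * (T - m)) *
      (1 - ((historyLaw π lam μ T).expect fun h => (pullCount 1 h : ℝ)) / m)) ≤
      (historyLaw π lam μ T).expect
        fun h => (1 / 3 : ℝ) ^ pullCount 1 h * (pullCount 0 h : ℝ) := by
    have hlin : ((historyLaw π lam μ T).expect fun h => 1 - (pullCount 1 h : ℝ) / m) =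
        1 - ((historyLaw π lam μ T).expect fun h => (pullCount 1 h : ℝ)) / m := by
      simp only [div_eq_inv_mul, PMF.expect_sub, PMF.expect_const_mul, PMF.expect_const]
    rw [← hlin, ← PMF.expect_const_mul]
    exact PMF.expect_mono _ fun h =>
      rpow_mul_markov_le hm0 (by linarith) _ _ (pullCount_add_pullCount h)
  refine le_trans ?_ hmarkov
  refine (log_div_eight_le_rpow_mul hTr).trans (mul_le_mul_of_nonneg_left ?_
    (mul_nonneg (by positivity) (by linarith)))
  have : ((historyLaw π lam μ T).expect fun h => (pullCount 1 h : ℝ)) / m ≤ 1 / 2 := by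
    rw [div_le_iff₀ hm0]
    linarith
  linarith

/-- Every policy schedules the worse server logarithmically often in one of two problems. -/
theorem exists_rates_log_le_pulls (π : Policy 2) (lam : I) :
    ∃ (μ : Fin 2 → I) (i₁ i₂ : Fin 2), μ i₁ < μ i₂ ∧ ∀ T₀ : ℕ, ∃ T : ℕ, T₀ < T ∧
      Real.log T / 8 ≤ ∑ t ∈ Finset.range T, pullProb π lam μ i₁ t := by
  -- The rates must not depend on `T`: if the first problem fails for all large `T`, the second
  -- works for all of them.
  by_cases hcase : ∀ T₀ : ℕ, ∃ T : ℕ, T₀ < T ∧ Real.log T / 8 ≤ ∑ t ∈ Finset.range T,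
      pullProb π lam ![quarterRate 2 (by norm_num), quarterRate 1 (by norm_num)] 1 t
  · exact ⟨_, 1, 0, by simp [quarterRate]; norm_num, hcase⟩
  · push Not at hcase
    obtain ⟨T₁, hT₁⟩ := hcase
    refine ⟨![quarterRate 2 (by norm_num), quarterRate 3 (by norm_num)], 0, 1,
      by simp [quarterRate]; norm_num, fun T₀ => ⟨T₀ + T₁ + 2, by omega, ?_⟩⟩
    exact (log_le_pulls_or_log_le_pulls π lam (by omega)).resolve_left
      (not_le.2 (hT₁ _ (by omega)))

/-- With two servers, `μ i₁ < μ i₂` says that the sorted rates are `μ_(1) = μ i₁` and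
`μ_(2) = μ i₂`, and that the best server `i₂` is unique. -/
theorem theorem1 (π : Policy 2) (hπ : π.IgnoresArrivals) :
    ∃ (μ : Fin 2 → unitInterval) (i₁ i₂ : Fin 2), μ i₁ < μ i₂ ∧
      ∀ lam : unitInterval, 0 < lam → lam < μ i₂ →
        IsBigOmega (regret π lam μ) (fun T : ℕ => Real.log T) := by
  obtain ⟨μ, i₁, i₂, hμ, hpulls⟩ := exists_rates_log_le_pulls π 0
  refine ⟨μ, i₁, i₂, hμ, fun lam hlam _ => ?_⟩
  have hbest : μ i₁ < μ (bestServer μ) := hμ.trans_le (le_bestServer μ i₂)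
  have hc : 0 < (μ (bestServer μ) - μ i₁ : ℝ) * lam :=
    mul_pos (sub_pos.2 hbest) hlam
  refine ⟨(μ (bestServer μ) - μ i₁ : ℝ) * lam / 16, by positivity, fun T₀ => ?_⟩
  obtain ⟨T, hT, hlog⟩ := hpulls (T₀ + ⌈Real.exp 32⌉₊)
  refine ⟨T, by omega, le_trans ?_ (le_abs_self _)⟩
  -- Ensures `log T / 8 - 2 ≥ log T / 16`.
  have hlarge : 32 ≤ Real.log T := by
    rw [Real.le_log_iff_exp_le (Nat.cast_pos.2 (by omega))]
    exact (Nat.le_ceil _).trans (by exact_mod_cast (by omega : ⌈Real.exp 32⌉₊ ≤ T))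
  simp only [pullProb_arrivalRate_congr hπ 0 lam] at hlog
  refine le_trans ?_ (gap_mul_sum_pullProb_le_regret hπ lam μ i₁ T)
  rw [div_mul_eq_mul_div, mul_div_assoc]
  exact mul_le_mul_of_nonneg_left (by linarith) hc.le
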